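/- Let $n \ge 2$, and let $\Omega = [A_0, A_1, \dots, A_n]$ be a non-degenerate $n$-simplex in Euclidean $n$-space, i.e. the convex hull of $n+1$ affinely independent points. Suppose that $\Omega$ is circumscriptible: there is a sphere tangent to all of its $n(n+1)/2$ edges, where the edges are the line segments $A_iA_j$ ($i \ne j$) and tangency to an edge means that the sphere is tangent to the line $A_iA_j$ at a point of the segment $A_iA_j$. Let $\rho$ be the radius of this sphere, let $R$ and $O$ be the circumradius and the circumcenter of $\Omega$, and let $G = \frac{1}{n+1}\sum_{i=0}^n A_i$ be its centroid. Then $$0 \le R^2 - \frac{2n}{n-1}\rho^2 \le (n+1)^2 |OG|^2 .$$ In particular, $R \ge \sqrt{\frac{2n}{n-1}}\,\rho$. -/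

import Mathlib

/-- `S` is an edge-tangent sphere of the simplex `Ω`: for any two different vertices, `S` is
tangent to the line through them at a point of the edge (the closed segment) joining them. -/
def IsEdgeTangentSphere {n : ℕ} (Ω : Affine.Simplex ℝ (EuclideanSpace ℝ (Fin n)) n)
    (S : EuclideanGeometry.Sphere (EuclideanSpace ℝ (Fin n))) : Prop :=
  ∀ i j : Fin (n + 1), i ≠ j →
    ∃ p ∈ segment ℝ (Ω.points i) (Ω.points j),
      S.IsTangentAt p (affineSpan ℝ {Ω.points i, Ω.points j})

/-! The two tangent segments from a vertex to the sphere are equal, so the edges are `x i + x j`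
with `x i` the tangent length at vertex `i`. Seen from the sphere's centre, the Gram matrix of the
vertices is then a diagonal matrix plus one of rank at most two, and it can be solved explicitly.
Put m = n + 1, u = 1/x, X = ∑x, Q = ∑x², p = ∑u, q = ∑u², D = p² - (m-2)q, E = X² - (m-2)Q. Then ρ²D
= 2(m-2) and 16(m-2)²R² = ρ²((pX - (m-2)(m-4))² - ED), while m²|OG|² = m²R² - (m-2)Q - X². Both
bounds become inequalities in x alone. The lower one (`tangent_length_lower`) is Aczél's inequality
together with pX ≥ m². The upper one (`tangent_length_upper`) depends on the sign of (m-3)(m-5), the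
coefficient of ED: Gerretsen's inequality for m = 3, a variance argument for m = 4, plain
Cauchy–Schwarz for m ≥ 5. -/

/-- Reverse Cauchy–Schwarz inequality of Aczél type. -/
lemma aczel_le {ι : Type*} [Fintype ι] (x u : ι → ℝ) {N : ℝ} (hN : 0 ≤ N)
    (hD : 0 < (∑ i, u i) ^ 2 - N * ∑ i, u i ^ 2) :
    ((∑ i, x i) ^ 2 - N * ∑ i, x i ^ 2) * ((∑ i, u i) ^ 2 - N * ∑ i, u i ^ 2) ≤
      ((∑ i, u i) * (∑ i, x i) - N * ∑ i, x i * u i) ^ 2 := by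
  set X := ∑ i, x i
  set p := ∑ i, u i
  set Q := ∑ i, x i ^ 2
  set q := ∑ i, u i ^ 2 with hq
  set C := ∑ i, x i * u i
  have hp : p ≠ 0 := by
    intro h
    have : 0 ≤ q := Finset.sum_nonneg fun i _ => sq_nonneg _
    rw [h] at hD
    nlinarith [mul_nonneg hN this]
  have key : 0 ≤ p ^ 2 * Q - 2 * p * X * C + X ^ 2 * q := by
    have h : ∑ i, (p * x i - X * u i) ^ 2 = p ^ 2 * Q - 2 * p * X * C + X ^ 2 * q := by
      simp only [Q, C, q, Finset.mul_sum, ← Finset.sum_sub_distrib, ← Finset.sum_add_distrib]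
      exact Finset.sum_congr rfl fun i _ => by ring
    rw [← h]
    exact Finset.sum_nonneg fun i _ => sq_nonneg _
  have hp2 : 0 < p ^ 2 := by positivity
  have h1 := mul_nonneg (mul_nonneg hN key) hD.le
  -- The right side equals (p(pX - NC) - XD)² + N·D·(p²Q - 2pXC + X²q), where D = p² - Nq.
  have h2 : 0 ≤ p ^ 2 * ((p * X - N * C) ^ 2 - (X ^ 2 - N * Q) * (p ^ 2 - N * q)) := by
    nlinarith [sq_nonneg (p * (p * X - N * C) - X * (p ^ 2 - N * q))]
  have := nonneg_of_mul_nonneg_right h2 hp2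
  linarith

/-! ### Inequalities for the tangent lengths -/

section

variable {ι : Type*} [Fintype ι] {x u : ι → ℝ}

lemma sum_mul_eq_card (hxu : ∀ i, x i * u i = 1) :
    ∑ i, x i * u i = (Fintype.card ι : ℝ) := by
  simp [hxu]

lemma card_sq_le_sum_mul_sum (hx : ∀ i, 0 < x i) (hxu : ∀ i, x i * u i = 1) :
    (Fintype.card ι : ℝ) ^ 2 ≤ (∑ i, u i) * ∑ i, x i := by
  have hu : ∀ i, 0 < u i := fun i => pos_of_mul_pos_right (by rw [hxu i]; norm_num) (hx i).le
  have h := Finset.sum_sq_le_sum_mul_sum_of_sq_le_mul Finset.univ (r := fun _ => (1 : ℝ))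
    (f := u) (g := x) (fun i _ => (hu i).le) (fun i _ => (hx i).le)
    (fun i _ => by rw [mul_comm, hxu i]; norm_num)
  simpa using h

/-- The numerical inequality behind the lower bound of the circumradius. -/
lemma tangent_length_lower (hx : ∀ i, 0 < x i) (hxu : ∀ i, x i * u i = 1) {m : ℝ}
    (hm : (Fintype.card ι : ℝ) = m) (hm2 : 2 ≤ m)
    (hD : 0 < (∑ i, u i) ^ 2 - (m - 2) * ∑ i, u i ^ 2) :
    ((∑ i, x i) ^ 2 - (m - 2) * ∑ i, x i ^ 2) * ((∑ i, u i) ^ 2 - (m - 2) * ∑ i, u i ^ 2) +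
        32 * (m - 1) * (m - 2) ≤
      ((∑ i, u i) * (∑ i, x i) - (m - 2) * (m - 4)) ^ 2 := by
  have h1 := aczel_le x u (by linarith : 0 ≤ m - 2) hD
  have h2 := card_sq_le_sum_mul_sum hx hxu
  rw [sum_mul_eq_card hxu, hm] at h1
  rw [hm] at h2
  -- The two squares differ by 8(m-2)(pX - (m-2)²), which is at least 32(m-1)(m-2) since pX ≥ m².
  nlinarith [mul_nonneg (by linarith : 0 ≤ m - 2) (sub_nonneg.2 h2)]

/-- Once (m-2)Q is written as X² - E, the product ED has coefficient (m-3)(m-5) ≥ 0, so crude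
Cauchy–Schwarz bounds on X²D and ED suffice. They are sharp when all `x i` are equal, that is, at e
= 0. -/
lemma upper_of_five_le {m X Q p q : ℝ} (hm : 5 ≤ m) (hP : m ^ 2 ≤ p * X)
    (hQ : X ^ 2 ≤ m * Q) (hq : p ^ 2 ≤ m * q) (hD : 0 < p ^ 2 - (m - 2) * q) :
    8 * (m - 2) * ((m - 2) * Q + X ^ 2) * (p ^ 2 - (m - 2) * q) ≤
      (m ^ 2 - 1) * ((p * X - (m - 2) * (m - 4)) ^ 2 -
        (X ^ 2 - (m - 2) * Q) * (p ^ 2 - (m - 2) * q)) + 32 * (m - 1) * (m - 2) := by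
  set D := p ^ 2 - (m - 2) * q with hDdef
  have hm0 : 0 < m := by linarith
  have hD2 : m * D ≤ 2 * p ^ 2 := by
    nlinarith [mul_le_mul_of_nonneg_left hq (by linarith : 0 ≤ m - 2)]
  have hE : m * (X ^ 2 - (m - 2) * Q) ≤ 2 * X ^ 2 := by
    nlinarith [mul_le_mul_of_nonneg_left hQ (by linarith : 0 ≤ m - 2)]
  set E := X ^ 2 - (m - 2) * Q with hEdef
  have hXD : m * (X ^ 2 * D) ≤ 2 * (p * X) ^ 2 := by
    nlinarith [mul_le_mul_of_nonneg_left hD2 (sq_nonneg X)]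
  have hED : m ^ 2 * (E * D) ≤ 4 * (p * X) ^ 2 := by
    nlinarith [mul_le_mul_of_nonneg_left hE (mul_nonneg hm0.le hD.le)]
  obtain ⟨e, he, hPe⟩ : ∃ e, 0 ≤ e ∧ p * X = m ^ 2 * (1 + e) :=
    ⟨p * X / m ^ 2 - 1, by rw [sub_nonneg, le_div_iff₀ (by positivity)]; linarith, by
      field_simp; ring⟩
  have hQE : (m - 2) * Q = X ^ 2 - E := by rw [hEdef]; ring
  rw [hQE]
  rw [hPe] at hXD hED ⊢
  have hk : 0 ≤ (m - 3) * (m - 5) := mul_nonneg (by linarith) (by linarith)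
  have h1 : X ^ 2 * D ≤ 2 * m ^ 3 * (1 + e) ^ 2 := by
    refine le_of_mul_le_mul_left ?_ hm0
    nlinarith
  have h2 : E * D ≤ 4 * m ^ 2 * (1 + e) ^ 2 := by
    refine le_of_mul_le_mul_left ?_ (by positivity : 0 < m ^ 2)
    nlinarith
  have h3 := mul_le_mul_of_nonneg_left h1 (by linarith : 0 ≤ 16 * (m - 2))
  have h4 := mul_le_mul_of_nonneg_left h2 hk
  obtain ⟨t, ht, rfl⟩ : ∃ t, 0 ≤ t ∧ m = 5 + t := ⟨m - 5, by linarith, by ring⟩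
  have h5 : 0 ≤ (4 + t) * (5 + t) ^ 2 * (((5 + t) ^ 2 * (6 + t) - 12 * (10 + 3 * t)) * e ^ 2 +
      (2 * (6 + t) * (22 + 6 * t) - 24 * (10 + 3 * t)) * e) := by
    have a1 : 0 ≤ (5 + t) ^ 2 * (6 + t) - 12 * (10 + 3 * t) := by
      have : (5 + t) ^ 2 * (6 + t) - 12 * (10 + 3 * t) = 30 + 49 * t + 16 * t ^ 2 + t ^ 3 := by
        ring
      rw [this]; positivity
    have a2 : 0 ≤ 2 * (6 + t) * (22 + 6 * t) - 24 * (10 + 3 * t) := by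
      have : 2 * (6 + t) * (22 + 6 * t) - 24 * (10 + 3 * t) = 24 + 44 * t + 12 * t ^ 2 := by ring
      rw [this]; positivity
    positivity
  nlinarith only [h3, h4, h5]

/-- Schur's inequality of degree one. -/
lemma schur_deg_one {a b c : ℝ} (ha : 0 ≤ a) (hb : 0 ≤ b) (hc : 0 ≤ c) :
    0 ≤ a * (a - b) * (a - c) + b * (b - a) * (b - c) + c * (c - a) * (c - b) := by
  have aux : ∀ {a b c : ℝ}, 0 ≤ c → c ≤ b → b ≤ a →
      0 ≤ a * (a - b) * (a - c) + b * (b - a) * (b - c) + c * (c - a) * (c - b) := by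
    intro a b c hc hcb hba
    have h1 : 0 ≤ (a - b) ^ 2 * (a + b - c) := mul_nonneg (sq_nonneg _) (by linarith)
    have h2 : 0 ≤ c * ((a - c) * (b - c)) :=
      mul_nonneg hc (mul_nonneg (by linarith) (by linarith))
    nlinarith only [h1, h2]
  rcases le_total a b with h1 | h1 <;> rcases le_total b c with h2 | h2 <;>
    rcases le_total a c with h3 | h3
  · linarith [aux ha h1 h2]
  · linarith [aux ha h1 h2]
  · linarith [aux ha h3 h2]
  · linarith [aux hc h3 h1]
  · linarith [aux hb h1 h3]
  · linarith [aux hb h2 h3]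
  · linarith [aux hc h2 h1]
  · linarith [aux hc h2 h1]

/-- Gerretsen's inequality in terms of the reciprocals of the tangent lengths. -/
lemma gerretsen_poly {a b c : ℝ} (ha : 0 ≤ a) (hb : 0 ≤ b) (hc : 0 ≤ c) :
    4 * (a * b + b * c + c * a) ^ 3 ≤
      ((a + b + c) * (a * b + b * c + c * a) + a * b * c) ^ 2 + 8 * (a * b * c) ^ 2 := by
  -- The difference of the two sides is 4abc times Schur's expression plus the squared discriminant.
  have h1 := mul_nonneg (mul_nonneg (mul_nonneg ha hb) hc) (schur_deg_one ha hb hc)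
  nlinarith only [h1, sq_nonneg ((a - b) * (b - c) * (c - a))]

/-- For m = 3 the ED terms cancel and Gerretsen's inequality remains. -/
lemma upper_three {x u : Fin 3 → ℝ} (hx : ∀ i, 0 < x i) (hxu : ∀ i, x i * u i = 1) :
    2 * (∑ i, x i) ^ 2 * ((∑ i, u i) ^ 2 - ∑ i, u i ^ 2) ≤
      ((∑ i, u i) * (∑ i, x i) + 1) ^ 2 + 8 := by
  have hu : ∀ i, 0 < u i := fun i => pos_of_mul_pos_right (by rw [hxu i]; norm_num) (hx i).le
  have hxe : ∀ i, x i = (u i)⁻¹ := fun i => eq_inv_of_mul_eq_one_left (hxu i)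
  simp only [Fin.sum_univ_three, hxe]
  have h := gerretsen_poly (hu 0).le (hu 1).le (hu 2).le
  generalize ha : u 0 = a at h ⊢
  generalize hb : u 1 = b at h ⊢
  generalize hc : u 2 = c at h ⊢
  have ha0 : 0 < a := ha ▸ hu 0
  have hb0 : 0 < b := hb ▸ hu 1
  have hc0 : 0 < c := hc ▸ hu 2
  have e1 : a⁻¹ + b⁻¹ + c⁻¹ = (a * b + b * c + c * a) / (a * b * c) := by
    field_simp; ring
  rw [e1, ← sub_nonneg]
  have e2 : ((a + b + c) * ((a * b + b * c + c * a) / (a * b * c)) + 1) ^ 2 + 8 -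
      2 * ((a * b + b * c + c * a) / (a * b * c)) ^ 2 *
        ((a + b + c) ^ 2 - (a ^ 2 + b ^ 2 + c ^ 2)) =
      (((a + b + c) * (a * b + b * c + c * a) + a * b * c) ^ 2 + 8 * (a * b * c) ^ 2 -
        4 * (a * b + b * c + c * a) ^ 3) / (a * b * c) ^ 2 := by
    field_simp; ring
  rw [e2]
  exact div_nonneg (sub_nonneg.2 h) (by positivity)

lemma sum_sq_le_of_sum_eq_four {x u : Fin 4 → ℝ} (hx : ∀ i, 0 < x i)
    (hxu : ∀ i, x i * u i = 1) (hX : ∑ i, x i = 4) :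
    ∑ i, x i ^ 2 + 8 ≤ 3 * ∑ i, u i := by
  have hu : ∀ i, 0 < u i := fun i => pos_of_mul_pos_right (by rw [hxu i]; norm_num) (hx i).le
  -- If all `x i` ≤ 3, a termwise bound touching at 1 suffices. Otherwise the other three sum to
  -- less than 1, and the tangent to 1/x at 1/3 makes their reciprocals sum to more than 9.
  by_cases h : ∀ i, x i ≤ 3
  · have key : ∀ i, x i ^ 2 + 7 - 5 * x i ≤ 3 * u i := fun i => by
      have h1 : 0 ≤ (x i - 1) ^ 2 * ((3 - x i) * u i) :=
        mul_nonneg (sq_nonneg _) (mul_nonneg (sub_nonneg.2 (h i)) (hu i).le)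
      have h2 : (x i - 1) ^ 2 * ((3 - x i) * u i) =
          3 * u i + (x i * u i) * (5 * x i - 7 - x i ^ 2) := by ring
      rw [h2, hxu i] at h1
      linarith
    have := Finset.sum_le_sum fun i (_ : i ∈ Finset.univ) => key i
    simp only [Fin.sum_univ_four] at this hX ⊢
    linarith
  · push Not at h
    obtain ⟨k, hk⟩ := h
    have key : ∀ i, 6 - 9 * x i ≤ u i := fun i => by
      have h1 : 0 ≤ (3 * x i - 1) ^ 2 * u i := mul_nonneg (sq_nonneg _) (hu i).le
      have h2 : (3 * x i - 1) ^ 2 * u i = u i + (x i * u i) * (9 * x i - 6) := by ring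
      rw [h2, hxu i] at h1
      linarith
    have hQ : ∑ i, x i ^ 2 ≤ 16 := by
      have := Finset.sum_sq_le_sq_sum_of_nonneg (s := Finset.univ) (f := x) fun i _ => (hx i).le
      rw [hX] at this
      linarith
    simp only [Fin.sum_univ_four] at hQ hX ⊢
    have k0 := key 0
    have k1 := key 1
    have k2 := key 2
    have k3 := key 3
    have u0 := hu 0
    have u1 := hu 1
    have u2 := hu 2
    have u3 := hu 3
    fin_cases k <;> simp only [Fin.zero_eta, Fin.mk_one, Fin.reduceFinMk] at hk <;> linarith

lemma centered_cauchy_schwarz (x u : ι → ℝ) {m : ℝ} (hm : (Fintype.card ι : ℝ) = m)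
    (hm0 : 0 < m) :
    (m * ∑ i, x i * u i - (∑ i, x i) * ∑ i, u i) ^ 2 ≤
      (m * ∑ i, x i ^ 2 - (∑ i, x i) ^ 2) * (m * ∑ i, u i ^ 2 - (∑ i, u i) ^ 2) := by
  have key : ∀ f g : ι → ℝ, ∑ i, (m * f i - ∑ j, f j) * (m * g i - ∑ j, g j) =
      m * (m * ∑ i, f i * g i - (∑ i, f i) * ∑ i, g i) := fun f g => by
    have : ∀ i, (m * f i - ∑ j, f j) * (m * g i - ∑ j, g j) =
        m ^ 2 * (f i * g i) - m * (∑ j, g j) * f i - m * (∑ j, f j) * g i +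
          (∑ j, f j) * ∑ j, g j := fun i => by ring
    simp only [this, Finset.sum_add_distrib, Finset.sum_sub_distrib, ← Finset.mul_sum,
      Finset.sum_const, Finset.card_univ, nsmul_eq_mul, hm]
    ring
  have h := Finset.sum_mul_sq_le_sq_mul_sq Finset.univ (fun i => m * x i - ∑ j, x j)
    (fun i => m * u i - ∑ j, u j)
  have kx := key x x
  have ku := key u u
  simp only [← pow_two] at kx ku
  rw [key, kx, ku] at h
  have hm2 : 0 < m ^ 2 := by positivity
  refine le_of_mul_le_mul_left ?_ hm2
  linarith

/-- Multiplying by V lets e² ≤ VW eliminate W; what remains uses V ≤ 3e for e ≤ 1 and V ≤ 3 for e ≥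
1. -/
lemma upper_four_aux {e V W : ℝ} (he : 0 ≤ e) (hV : 0 ≤ V) (hW : 0 ≤ W) (hVW : e ^ 2 ≤ V * W)
    (hVe : V ≤ 3 * e) (hV3 : V ≤ 3) :
    (63 + V) * ((1 + e) ^ 2 - W) ≤ 60 * (1 + e) ^ 2 + 3 := by
  rcases hV.eq_or_lt with h0 | h0
  · have : e = 0 := by
      rw [← h0, zero_mul] at hVW
      exact pow_eq_zero_iff two_ne_zero |>.1 (le_antisymm hVW (sq_nonneg e))
    subst this
    rw [← h0]
    linarith
  have h1 : V * (2 * e ^ 2 + 6 * e) + V ^ 2 * (1 + e) ^ 2 ≤ 63 * e ^ 2 := by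
    rcases le_total e 1 with h | h
    · calc V * (2 * e ^ 2 + 6 * e) + V ^ 2 * (1 + e) ^ 2
          ≤ (3 * e) * (2 * e ^ 2 + 6 * e) + (3 * e) ^ 2 * (1 + e) ^ 2 := by gcongr
        _ ≤ 63 * e ^ 2 := by
          have : 0 ≤ e ^ 2 * ((1 - e) * (33 + 9 * e)) + 3 * e ^ 2 := by
            have := sub_nonneg.2 h
            positivity
          nlinarith only [this]
    · calc V * (2 * e ^ 2 + 6 * e) + V ^ 2 * (1 + e) ^ 2
          ≤ 3 * (2 * e ^ 2 + 6 * e) + 3 ^ 2 * (1 + e) ^ 2 := by gcongr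
        _ ≤ 63 * e ^ 2 := by nlinarith only [h]
  have h2 : 0 ≤ V * (60 * (1 + e) ^ 2 + 3 - (63 + V) * ((1 + e) ^ 2 - W)) := by
    nlinarith only [h1, mul_le_mul_of_nonneg_left hVW (by linarith : 0 ≤ 63 + V)]
  have := nonneg_of_mul_nonneg_right h2 h0
  linarith

lemma upper_four_normalized {x u : Fin 4 → ℝ} (hx : ∀ i, 0 < x i)
    (hxu : ∀ i, x i * u i = 1) (hX : ∑ i, x i = 4) :
    (31 * 4 ^ 2 + 2 * ∑ i, x i ^ 2) * ((∑ i, u i) ^ 2 - 2 * ∑ i, u i ^ 2) ≤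
      15 * ((∑ i, u i) * 4) ^ 2 + 192 := by
  have h1 := sum_sq_le_of_sum_eq_four hx hxu hX
  have h2 := centered_cauchy_schwarz x u (m := 4) (by simp) (by norm_num)
  have h3 := card_sq_le_sum_mul_sum hx hxu
  have h4 := sq_sum_le_card_mul_sum_sq (s := Finset.univ) (f := x)
  have h5 := sq_sum_le_card_mul_sum_sq (s := Finset.univ) (f := u)
  have h6 := Finset.sum_sq_le_sq_sum_of_nonneg (s := Finset.univ) (f := x) fun i _ => (hx i).le
  rw [sum_mul_eq_card hxu] at h2
  simp only [hX, Fintype.card_fin, Finset.card_univ, Nat.cast_ofNat] at h1 h2 h3 h4 h5 h6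
  generalize ∑ i, x i ^ 2 = Q at *
  generalize ∑ i, u i ^ 2 = q at *
  generalize ∑ i, u i = p at *
  -- V and W are the variances of x and u, 1 + e is the mean of u, and the covariance is -e.
  have := upper_four_aux (e := p / 4 - 1) (V := Q / 4 - 1) (W := q / 4 - p ^ 2 / 16)
    (by linarith) (by linarith) (by linarith) (by nlinarith only [h2]) (by linarith)
    (by linarith)
  nlinarith only [this]

lemma upper_four {x u : Fin 4 → ℝ} (hx : ∀ i, 0 < x i) (hxu : ∀ i, x i * u i = 1) :
    (31 * (∑ i, x i) ^ 2 + 2 * ∑ i, x i ^ 2) * ((∑ i, u i) ^ 2 - 2 * ∑ i, u i ^ 2) ≤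
      15 * ((∑ i, u i) * ∑ i, x i) ^ 2 + 192 := by
  have hX : 0 < ∑ i, x i := Finset.sum_pos (fun i _ => hx i) Finset.univ_nonempty
  set X := ∑ i, x i with hXdef
  have h := upper_four_normalized (x := fun i => 4 / X * x i) (u := fun i => X / 4 * u i)
    (fun i => mul_pos (by positivity) (hx i))
    (fun i => by
      have : 4 / X * x i * (X / 4 * u i) = x i * u i := by field_simp
      rw [this, hxu i])
    (by rw [← Finset.mul_sum, ← hXdef]; field_simp)
  simp only [mul_pow, ← Finset.mul_sum] at h
  have e1 : ∀ Q p q : ℝ, (31 * 4 ^ 2 + 2 * ((4 / X) ^ 2 * Q)) *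
      ((X / 4) ^ 2 * p ^ 2 - 2 * ((X / 4) ^ 2 * q)) =
      (31 * X ^ 2 + 2 * Q) * (p ^ 2 - 2 * q) := fun Q p q => by field_simp
  rw [e1] at h
  convert h using 2
  ring

/-- The numerical inequality behind the upper bound of the circumradius. -/
lemma tangent_length_upper {n : ℕ} (hn : 2 ≤ n) {x u : Fin (n + 1) → ℝ} (hx : ∀ i, 0 < x i)
    (hxu : ∀ i, x i * u i = 1) {m : ℝ} (hm : (n : ℝ) + 1 = m)
    (hD : 0 < (∑ i, u i) ^ 2 - (m - 2) * ∑ i, u i ^ 2) :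
    8 * (m - 2) * ((m - 2) * ∑ i, x i ^ 2 + (∑ i, x i) ^ 2) *
        ((∑ i, u i) ^ 2 - (m - 2) * ∑ i, u i ^ 2) ≤
      (m ^ 2 - 1) * (((∑ i, u i) * (∑ i, x i) - (m - 2) * (m - 4)) ^ 2 -
        ((∑ i, x i) ^ 2 - (m - 2) * ∑ i, x i ^ 2) *
          ((∑ i, u i) ^ 2 - (m - 2) * ∑ i, u i ^ 2)) + 32 * (m - 1) * (m - 2) := by
  obtain rfl | rfl | h4 : n = 2 ∨ n = 3 ∨ 4 ≤ n := by omega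
  · obtain rfl : m = 3 := by rw [← hm]; norm_num
    have := upper_three hx hxu
    nlinarith only [this]
  · obtain rfl : m = 4 := by rw [← hm]; norm_num
    have := upper_four hx hxu
    nlinarith only [this]
  · have h4' : (4 : ℝ) ≤ n := by exact_mod_cast h4
    have hc : (Fintype.card (Fin (n + 1)) : ℝ) = m := by simpa using hm
    refine upper_of_five_le (by linarith) ?_ ?_ ?_ hD
    · rw [← hc]; exact card_sq_le_sum_mul_sum hx hxu
    · rw [← hc]; exact sq_sum_le_card_mul_sum_sq
    · rw [← hc]; exact sq_sum_le_card_mul_sum_sq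

end

/-! ### Solving the Gram system -/

open scoped RealInnerProductSpace in
/-- Weighted sums of vectors with the Gram matrix of the vertices seen from the centre of an
edge-tangent sphere. -/
lemma inner_sum_smul_of_gram {ι V : Type*} [Fintype ι] [DecidableEq ι] [NormedAddCommGroup V]
    [InnerProductSpace ℝ V] {v : ι → V} {x : ι → ℝ} {r : ℝ}
    (hv : ∀ i j, ⟪v i, v j⟫ = r - x i * x j + if i = j then 2 * x i ^ 2 else 0)
    (w : ι → ℝ) (i : ι) :
    ⟪v i, ∑ j, w j • v j⟫ = r * ∑ j, w j - x i * ∑ j, w j * x j + 2 * x i ^ 2 * w i := by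
  have : ∀ j, w j * ⟪v i, v j⟫ =
      r * w j - x i * (w j * x j) + if i = j then 2 * x i ^ 2 * w j else 0 := fun j => by
    rw [hv]
    split_ifs <;> ring
  simp only [inner_sum, real_inner_smul_right, this, Finset.sum_add_distrib,
    Finset.sum_sub_distrib, ← Finset.mul_sum, Finset.sum_ite_eq, Finset.mem_univ, if_true]

/-- The radius of the edge-tangent sphere in terms of the tangent lengths. -/
lemma tangent_radius_eq {ι : Type*} [Fintype ι] {x u l : ι → ℝ} {r m : ℝ}
    (hm : (Fintype.card ι : ℝ) = m) (hxu : ∀ i, x i * u i = 1) (hl : ∑ i, l i = 1)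
    (h : ∀ i, r - x i * ∑ j, l j * x j + 2 * x i ^ 2 * l i = 0) :
    r * ((∑ i, u i) ^ 2 - (m - 2) * ∑ i, u i ^ 2) = 2 * (m - 2) := by
  set s := ∑ j, l j * x j with hs
  -- Dividing by x² gives l in terms of s; summing l and l·x gives two linear equations, from which
  -- s is eliminated.
  have h1 : ∀ i, 2 * l i = s * u i - r * u i ^ 2 := fun i => by
    linear_combination u i ^ 2 * h i + (s * u i - 2 * l i * (x i * u i + 1)) * hxu i
  have h2 : ∀ i, 2 * (l i * x i) = s - r * u i := fun i => by
    linear_combination x i * h1 i + (s - r * u i) * hxu i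
  have s1 := Finset.sum_congr (rfl : Finset.univ = Finset.univ) fun i _ => h1 i
  have s2 := Finset.sum_congr (rfl : Finset.univ = Finset.univ) fun i _ => h2 i
  simp only [← Finset.mul_sum, Finset.sum_sub_distrib, hl, ← hs, Finset.sum_const,
    Finset.card_univ, nsmul_eq_mul, hm] at s1 s2
  linear_combination (∑ i, u i) * s2 - (m - 2) * s1

/-- The power of the centre of the edge-tangent sphere, and the distance to the circumcentre, in
terms of the tangent lengths. -/
lemma circumcenter_relations {ι : Type*} [Fintype ι] {x u k : ι → ℝ} {c m : ℝ}
    (hm : (Fintype.card ι : ℝ) = m) (hxu : ∀ i, x i * u i = 1) (hk : ∑ i, k i = 0)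
    (h : ∀ i, -x i * ∑ j, k j * x j + 2 * x i ^ 2 * k i = (x i ^ 2 + c) / 2) :
    c * ((∑ i, u i) ^ 2 - (m - 2) * ∑ i, u i ^ 2) =
        (m - 2) * m - (∑ i, u i) * ∑ i, x i ∧
      8 * (m - 2) * ∑ i, k i * x i ^ 2 = 2 * (m - 2) * (∑ i, x i ^ 2 + c * m) -
        2 * (∑ i, x i) * (∑ i, x i + c * ∑ i, u i) := by
  set t := ∑ j, k j * x j with ht
  have h1 : ∀ i, 4 * k i = 1 + c * u i ^ 2 + 2 * t * u i := fun i => by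
    linear_combination 2 * u i ^ 2 * h i +
      (2 * t * u i + (1 - 4 * k i) * (x i * u i + 1)) * hxu i
  have h2 : ∀ i, 4 * (k i * x i) = x i + c * u i + 2 * t := fun i => by
    linear_combination x i * h1 i + (c * u i + 2 * t) * hxu i
  have h3 : ∀ i, 4 * (k i * x i ^ 2) = x i ^ 2 + c + 2 * t * x i := fun i => by
    linear_combination x i * h2 i + c * hxu i
  have s1 := Finset.sum_congr (rfl : Finset.univ = Finset.univ) fun i _ => h1 i
  have s2 := Finset.sum_congr (rfl : Finset.univ = Finset.univ) fun i _ => h2 i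
  have s3 := Finset.sum_congr (rfl : Finset.univ = Finset.univ) fun i _ => h3 i
  simp only [← Finset.mul_sum, Finset.sum_add_distrib, hk, ← ht, Finset.sum_const,
    Finset.card_univ, nsmul_eq_mul, hm] at s1 s2 s3
  constructor
  · linear_combination (m - 2) * s1 - (∑ i, u i) * s2
  · linear_combination 2 * (m - 2) * s3 - 2 * (∑ i, x i) * s2

/-! ### Geometry of the simplex -/

lemma IsEdgeTangentSphere.exists_tangent_lengths {n : ℕ} (hn : 2 ≤ n)
    {Ω : Affine.Simplex ℝ (EuclideanSpace ℝ (Fin n)) n}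
    {S : EuclideanGeometry.Sphere (EuclideanSpace ℝ (Fin n))} (hS : IsEdgeTangentSphere Ω S) :
    ∃ x : Fin (n + 1) → ℝ, (∀ i, 0 < x i) ∧
      (∀ i, dist (Ω.points i) S.center ^ 2 = S.radius ^ 2 + x i ^ 2) ∧
      ∀ i j, i ≠ j → dist (Ω.points i) (Ω.points j) = x i + x j := by
  have key : ∀ i j, i ≠ j → ∃ p ∈ segment ℝ (Ω.points i) (Ω.points j),
      dist (Ω.points i) p =
        Real.sqrt (dist (Ω.points i) S.center ^ 2 - S.radius ^ 2) ∧
      dist (Ω.points j) p =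
        Real.sqrt (dist (Ω.points j) S.center ^ 2 - S.radius ^ 2) := fun i j hij => by
    obtain ⟨p, hp, ht⟩ := hS i j hij
    refine ⟨p, hp, ?_, ?_⟩
    · rw [ht.dist_sq_eq_of_mem (left_mem_affineSpan_pair ℝ _ _), add_sub_cancel_left,
        Real.sqrt_sq dist_nonneg]
    · rw [ht.dist_sq_eq_of_mem (right_mem_affineSpan_pair ℝ _ _), add_sub_cancel_left,
        Real.sqrt_sq dist_nonneg]
  have : Nontrivial (Fin (n + 1)) := Fin.nontrivial_iff_two_le.2 (by omega)
  have hdist : ∀ i j, i ≠ j → dist (Ω.points i) (Ω.points j) =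
      Real.sqrt (dist (Ω.points i) S.center ^ 2 - S.radius ^ 2) +
        Real.sqrt (dist (Ω.points j) S.center ^ 2 - S.radius ^ 2) := fun i j hij => by
    obtain ⟨p, hp, h1, h2⟩ := key i j hij
    rw [← h1, ← h2, dist_comm (Ω.points j) p, dist_add_dist_of_mem_segment hp]
  refine ⟨fun i => Real.sqrt (dist (Ω.points i) S.center ^ 2 - S.radius ^ 2), fun i => ?_,
    fun i => ?_, hdist⟩
  -- A zero tangent length at `i` would put vertex `i` between two others, against affine
  -- independence; this needs a third vertex, hence n ≥ 2.
  · refine (Real.sqrt_nonneg _).lt_of_ne fun h0 => ?_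
    obtain ⟨j, hj⟩ := exists_ne i
    obtain ⟨k, hki, hkj⟩ : ∃ k, k ≠ i ∧ k ≠ j := by
      obtain ⟨k, -, hk⟩ := Finset.exists_mem_notMem_of_card_lt_card
        (s := ({i, j} : Finset (Fin (n + 1)))) (t := Finset.univ)
        (Finset.card_le_two.trans_lt (by simp; omega))
      exact ⟨k, by simpa using hk⟩
    have hji := hdist j i hj
    have hik := hdist i k hki.symm
    have hjk := hdist j k hkj.symm
    rw [← h0] at hji hik
    have hw : Wbtw ℝ (Ω.points j) (Ω.points i) (Ω.points k) :=
      dist_add_dist_eq_iff.1 (by rw [hji, hik, hjk]; ring)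
    have hcol : Collinear ℝ ({Ω.points j, Ω.points i, Ω.points k} : Set _) := hw.collinear
    have hind := Ω.independent.comp_embedding
      (⟨![j, i, k], by
        intro a b hab
        fin_cases a <;> fin_cases b <;> simp_all [eq_comm]⟩ : Fin 3 ↪ Fin (n + 1))
    refine (affineIndependent_iff_not_collinear_set.1 ?_) hcol
    have heq : ![Ω.points j, Ω.points i, Ω.points k] = Ω.points ∘ ![j, i, k] := by
      funext a
      fin_cases a <;> rfl
    rw [heq]
    exact hind
  · obtain ⟨j, hj⟩ := exists_ne i
    obtain ⟨p, hp, ht⟩ := hS i j hj.symm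
    have := ht.dist_sq_eq_of_mem (left_mem_affineSpan_pair ℝ _ _)
    rw [Real.sq_sqrt (by rw [this, add_sub_cancel_left]; positivity)]
    ring

lemma Affine.Simplex.exists_weights_vsub {n : ℕ}
    (Ω : Affine.Simplex ℝ (EuclideanSpace ℝ (Fin n)) n) (p q : EuclideanSpace ℝ (Fin n)) :
    ∃ w : Fin (n + 1) → ℝ, ∑ i, w i = 1 ∧ p - q = ∑ i, w i • (Ω.points i - q) := by
  have htop : affineSpan ℝ (Set.range Ω.points) = ⊤ :=
    Ω.independent.affineSpan_eq_top_iff_card_eq_finrank_add_one.2 (by simp)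
  obtain ⟨w, hw, hp⟩ := eq_affineCombination_of_mem_affineSpan_of_fintype
    (k := ℝ) (p1 := p) (p := Ω.points) (by rw [htop]; trivial)
  refine ⟨w, hw, ?_⟩
  have := Finset.sum_smul_vsub_const_eq_affineCombination_vsub Finset.univ w Ω.points q hw
  rw [← hp] at this
  simpa using this.symm

/-- Distance from circumcentre to centroid when the edges are sums of tangent lengths. -/
lemma Affine.Simplex.dist_circumcenter_centroid_sq {n : ℕ}
    (Ω : Affine.Simplex ℝ (EuclideanSpace ℝ (Fin n)) n) {x : Fin (n + 1) → ℝ}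
    (hx : ∀ i j, i ≠ j → dist (Ω.points i) (Ω.points j) = x i + x j) :
    ((n : ℝ) + 1) ^ 2 * dist Ω.circumcenter Ω.centroid ^ 2 =
      ((n : ℝ) + 1) ^ 2 * Ω.circumradius ^ 2 - ((n : ℝ) - 1) * ∑ i, x i ^ 2 -
        (∑ i, x i) ^ 2 := by
  have hn : (n : ℝ) + 1 ≠ 0 := by positivity
  have h1 : ((n : ℝ) + 1) • (Ω.centroid - Ω.circumcenter) =
      ∑ i, (Ω.points i - Ω.circumcenter) := by
    have := Ω.centroid_vsub_eq Ω.circumcenter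
    simp only [vsub_eq_sub] at this
    rw [this, smul_smul, mul_inv_cancel₀ hn, one_smul]
  have h2 : ∀ i j, inner ℝ (Ω.points i - Ω.circumcenter) (Ω.points j - Ω.circumcenter) =
      Ω.circumradius ^ 2 - (x i ^ 2 / 2 + x j ^ 2 / 2 + x i * x j) +
        if i = j then 2 * x i ^ 2 else 0 := fun i j => by
    have hi : ‖Ω.points i - Ω.circumcenter‖ = Ω.circumradius := by
      rw [← dist_eq_norm, Ω.dist_circumcenter_eq_circumradius]
    have hj : ‖Ω.points j - Ω.circumcenter‖ = Ω.circumradius := by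
      rw [← dist_eq_norm, Ω.dist_circumcenter_eq_circumradius]
    rw [real_inner_eq_norm_mul_self_add_norm_mul_self_sub_norm_sub_mul_self_div_two, hi, hj,
      sub_sub_sub_cancel_right, ← dist_eq_norm]
    split_ifs with h
    · subst h; simp; ring
    · rw [hx i j h]; ring
  have h3 : ‖((n : ℝ) + 1) • (Ω.centroid - Ω.circumcenter)‖ ^ 2 =
      ((n : ℝ) + 1) ^ 2 * dist Ω.circumcenter Ω.centroid ^ 2 := by
    rw [norm_smul, mul_pow, dist_comm, dist_eq_norm, Real.norm_eq_abs, sq_abs]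
  rw [← h3, h1, ← real_inner_self_eq_norm_sq, sum_inner]
  simp only [inner_sum, h2]
  simp only [Finset.sum_add_distrib, Finset.sum_sub_distrib, Finset.sum_ite_eq,
    Finset.mem_univ, if_true, Finset.sum_const, Finset.card_univ, Fintype.card_fin,
    nsmul_eq_mul, ← Finset.mul_sum, ← Finset.sum_mul, ← Finset.sum_div]
  push_cast
  ring

lemma IsEdgeTangentSphere.inner_vertices {n : ℕ}
    {Ω : Affine.Simplex ℝ (EuclideanSpace ℝ (Fin n)) n}
    {S : EuclideanGeometry.Sphere (EuclideanSpace ℝ (Fin n))} {x : Fin (n + 1) → ℝ}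
    (hc : ∀ i, dist (Ω.points i) S.center ^ 2 = S.radius ^ 2 + x i ^ 2)
    (hx : ∀ i j, i ≠ j → dist (Ω.points i) (Ω.points j) = x i + x j) (i j : Fin (n + 1)) :
    inner ℝ (Ω.points i - S.center) (Ω.points j - S.center) =
      S.radius ^ 2 - x i * x j + if i = j then 2 * x i ^ 2 else 0 := by
  rw [real_inner_eq_norm_mul_self_add_norm_mul_self_sub_norm_sub_mul_self_div_two,
    sub_sub_sub_cancel_right, ← dist_eq_norm, ← dist_eq_norm, ← dist_eq_norm, ← pow_two,
    ← pow_two, hc, hc]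
  split_ifs with h
  · subst h; simp; ring
  · rw [hx i j h]; ring

/-- The radius of the edge-tangent sphere and the circumradius in terms of the tangent lengths
and their reciprocals. -/
lemma IsEdgeTangentSphere.radius_formulas {n : ℕ}
    {Ω : Affine.Simplex ℝ (EuclideanSpace ℝ (Fin n)) n}
    {S : EuclideanGeometry.Sphere (EuclideanSpace ℝ (Fin n))} {x u : Fin (n + 1) → ℝ} {m : ℝ}
    (hm : (n : ℝ) + 1 = m) (hxu : ∀ i, x i * u i = 1)
    (hc : ∀ i, dist (Ω.points i) S.center ^ 2 = S.radius ^ 2 + x i ^ 2)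
    (hx : ∀ i j, i ≠ j → dist (Ω.points i) (Ω.points j) = x i + x j) :
    S.radius ^ 2 * ((∑ i, u i) ^ 2 - (m - 2) * ∑ i, u i ^ 2) = 2 * (m - 2) ∧
      16 * (m - 2) ^ 2 * Ω.circumradius ^ 2 =
        S.radius ^ 2 * ((∑ i, u i) * (∑ i, x i) - (m - 2) * (m - 4)) ^ 2 -
          2 * (m - 2) * ((∑ i, x i) ^ 2 - (m - 2) * ∑ i, x i ^ 2) := by
  have hcard : (Fintype.card (Fin (n + 1)) : ℝ) = m := by simpa using hm
  have hgram := inner_sum_smul_of_gram (IsEdgeTangentSphere.inner_vertices hc hx)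
  obtain ⟨l, hl, hl0⟩ := Ω.exists_weights_vsub S.center S.center
  obtain ⟨v, hv, hv0⟩ := Ω.exists_weights_vsub Ω.circumcenter S.center
  have hL : ∀ i, S.radius ^ 2 - x i * ∑ j, l j * x j + 2 * x i ^ 2 * l i = 0 := fun i => by
    have := hgram l i
    rw [← hl0, sub_self, inner_zero_right, hl, mul_one] at this
    exact this.symm
  have hr := tangent_radius_eq hcard hxu hl hL
  set w := Ω.circumcenter - S.center with hw
  set c := S.radius ^ 2 + ‖w‖ ^ 2 - Ω.circumradius ^ 2 with hcdef
  have hinner : ∀ i, inner ℝ (Ω.points i - S.center) w = (x i ^ 2 + c) / 2 := fun i => by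
    have h1 : Ω.points i - S.center - w = Ω.points i - Ω.circumcenter := by rw [hw]; abel
    rw [real_inner_eq_norm_mul_self_add_norm_mul_self_sub_norm_sub_mul_self_div_two, h1,
      ← dist_eq_norm, ← dist_eq_norm (Ω.points i) Ω.circumcenter,
      Ω.dist_circumcenter_eq_circumradius, ← pow_two, hc, hcdef]
    ring
  -- The coefficients `v - l` of `w` sum to zero, which removes the ρ² term of the Gram matrix.
  have hK : ∀ i, -x i * ∑ j, (v j - l j) * x j + 2 * x i ^ 2 * (v i - l i) =
      (x i ^ 2 + c) / 2 := fun i => by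
    have h1 := hgram v i
    rw [← hv0, hv, hinner] at h1
    simp only [sub_mul, Finset.sum_sub_distrib]
    linear_combination -h1 - hL i
  have hsum : ∑ i, (v i - l i) = 0 := by rw [Finset.sum_sub_distrib, hv, hl, sub_self]
  obtain ⟨h1, h2⟩ := circumcenter_relations hcard hxu hsum hK
  have hnorm : 2 * ‖w‖ ^ 2 = ∑ i, (v i - l i) * x i ^ 2 := by
    have e1 : ‖w‖ ^ 2 = ∑ i, (v i - l i) * ((x i ^ 2 + c) / 2) := by
      have : w = ∑ i, (v i - l i) • (Ω.points i - S.center) := by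
        simp only [sub_smul, Finset.sum_sub_distrib]
        rw [← hv0, ← hl0, sub_self, sub_zero]
      rw [← real_inner_self_eq_norm_sq]
      nth_rewrite 1 [this]
      simp only [sum_inner, real_inner_smul_left, hinner]
    have e2 : ∀ i, (v i - l i) * ((x i ^ 2 + c) / 2) =
        (v i - l i) * x i ^ 2 * (1 / 2) + (v i - l i) * (c / 2) := fun i => by ring
    rw [e1]
    simp only [e2, Finset.sum_add_distrib, ← Finset.sum_mul, hsum]
    ring
  refine ⟨hr, ?_⟩
  rw [← hnorm] at h2
  have h3 : 2 * (m - 2) * c =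
      S.radius ^ 2 * ((m - 2) * m - (∑ i, u i) * ∑ i, x i) := by
    rw [← h1, ← hr]; ring
  have h4 : Ω.circumradius ^ 2 = S.radius ^ 2 + ‖w‖ ^ 2 - c := by rw [hcdef]; ring
  rw [h4]
  linear_combination (m - 2) * h2 +
    ((m - 2) * (m - 8) - (∑ i, u i) * ∑ i, x i) * h3

/-! ### Conclusion -/

theorem theorem2p2 (n : ℕ) (hn : 2 ≤ n)
    (Ω : Affine.Simplex ℝ (EuclideanSpace ℝ (Fin n)) n)
    (S : EuclideanGeometry.Sphere (EuclideanSpace ℝ (Fin n)))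
    (hS : IsEdgeTangentSphere Ω S) :
    (0 ≤ Ω.circumradius ^ 2 - 2 * (n : ℝ) / ((n : ℝ) - 1) * S.radius ^ 2 ∧
      Ω.circumradius ^ 2 - 2 * (n : ℝ) / ((n : ℝ) - 1) * S.radius ^ 2 ≤
        ((n : ℝ) + 1) ^ 2 * dist Ω.circumcenter Ω.centroid ^ 2) ∧
    Real.sqrt (2 * (n : ℝ) / ((n : ℝ) - 1)) * S.radius ≤ Ω.circumradius := by

  obtain ⟨x, hx, hc, hd⟩ := hS.exists_tangent_lengths hn
  have hxu : ∀ i, x i * (x i)⁻¹ = 1 := fun i => mul_inv_cancel₀ (hx i).ne'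
  have hn' : (2 : ℝ) ≤ n := by exact_mod_cast hn
  obtain ⟨m, hm⟩ : ∃ m, (n : ℝ) + 1 = m := ⟨_, rfl⟩
  have hcard : (Fintype.card (Fin (n + 1)) : ℝ) = m := by simpa using hm
  have hnm : (n : ℝ) = m - 1 := by linarith
  have hm3 : 3 ≤ m := by linarith
  obtain ⟨hr, hR⟩ := IsEdgeTangentSphere.radius_formulas hm hxu hc hd
  have hrD : 0 < S.radius ^ 2 *
      ((∑ i, (x i)⁻¹) ^ 2 - (m - 2) * ∑ i, (x i)⁻¹ ^ 2) := by rw [hr]; linarith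
  have hD := pos_of_mul_pos_right hrD (sq_nonneg _)
  have hlow := tangent_length_lower hx hxu hcard (by linarith) hD
  have hupp := tangent_length_upper hn hx hxu hm hD
  have hG := Ω.dist_circumcenter_centroid_sq hd
  have hN : 0 < m - 2 := by linarith
  have hN2 : 0 < 16 * (m - 2) ^ 2 := by positivity
  have e1 : 2 * (n : ℝ) / ((n : ℝ) - 1) = 2 * (m - 1) / (m - 2) := by
    rw [hnm]; congr 1; ring
  have hk : (m - 2) * (2 * (m - 1) / (m - 2)) = 2 * (m - 1) := by field_simp
  rw [hG, e1, hm, show (n : ℝ) - 1 = m - 2 by linarith]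
  generalize 2 * (m - 1) / (m - 2) = k at *
  generalize ∑ i, (x i)⁻¹ ^ 2 = q at *
  generalize ∑ i, (x i)⁻¹ = p at *
  generalize ∑ i, x i ^ 2 = Q at *
  generalize ∑ i, x i = X at *
  have h1 := mul_le_mul_of_nonneg_left hlow (sq_nonneg S.radius)
  have h2 := mul_le_mul_of_nonneg_left hupp (sq_nonneg S.radius)
  have low : 0 ≤ Ω.circumradius ^ 2 - k * S.radius ^ 2 := by
    refine nonneg_of_mul_nonneg_right ?_ hN2
    have : 16 * (m - 2) ^ 2 * (Ω.circumradius ^ 2 - k * S.radius ^ 2) =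
        S.radius ^ 2 * (p * X - (m - 2) * (m - 4)) ^ 2 - S.radius ^ 2 *
          ((X ^ 2 - (m - 2) * Q) * (p ^ 2 - (m - 2) * q) + 32 * (m - 1) * (m - 2)) := by
      linear_combination hR - 16 * (m - 2) * S.radius ^ 2 * hk + (X ^ 2 - (m - 2) * Q) * hr
    rw [this]
    linarith
  refine ⟨⟨low, ?_⟩, ?_⟩
  · rw [← sub_nonneg]
    refine nonneg_of_mul_nonneg_right ?_ hN2
    rw [← sub_nonneg] at h2
    refine h2.trans_eq ?_
    linear_combination -(m ^ 2 - 1) * hR - 16 * (m - 2) * S.radius ^ 2 * hk +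
      (-(m ^ 2 - 1) * (X ^ 2 - (m - 2) * Q) - 8 * (m - 2) * ((m - 2) * Q + X ^ 2)) * hr
  · rw [← Real.sqrt_sq Ω.circumradius_nonneg]
    refine Real.le_sqrt_of_sq_le ?_
    rw [mul_pow]
    have hk0 : 0 ≤ k := by
      refine nonneg_of_mul_nonneg_right ?_ hN
      rw [hk]; linarith
    rw [Real.sq_sqrt hk0]
    linarith
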